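/- Let $r \ge 0$ be an integer and let $0<\alpha<1$. A finite set $X\subset\mathbb{R}^r$ of unit vectors is called equiangular with angle $\alpha$ if $\langle x,y\rangle\in\{\alpha,-\alpha\}$ for all distinct $x,y\in X$. Two real $k\times k$ matrices $G,H$ are switching equivalent, written $G\cong H$, if $(CB)^{\top}G\,(CB)=H$ for some permutation matrix $C$ and some diagonal matrix $B$ with diagonal entries $\pm1$. For a nonempty equiangular set $X$ with angle $\alpha$, the base size $K_\alpha(X)$ is the largest positive integer $k$ for which there are $p_1,\dots,p_k\in X$ whose Gram matrix satisfies $G(p_1,\dots,p_k)\cong(1+\alpha)I-\alpha J$, where $I$ is the $k\times k$ identity matrix and $J$ is the $k\times k$ all-one matrix. Lemma. Let $X\subset\mathbb{R}^r$ be an equiangular set with angle $1/5$. If $K_{1/5}(X)=5$, then \[ |X|\;\le\;\begin{cases} 290, & 23\le r\le 185,\\[2pt] r+15+\lfloor (r-5)/2\rfloor, & r\ge 185.\end{cases} \] -/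

import Mathlib

/-- The finite set `X ⊆ ℝ^r` is equiangular with angle `α`: `0 < α < 1`, every vector of `X` is a
unit vector, and any two distinct vectors of `X` have inner product `α` or `-α`. -/
def IsEquiangular {r : ℕ} (α : ℝ) (X : Finset (EuclideanSpace ℝ (Fin r))) : Prop :=
  0 < α ∧ α < 1 ∧ (∀ x ∈ X, inner ℝ x x = 1) ∧
    ∀ x ∈ X, ∀ y ∈ X, x ≠ y → inner ℝ x y = α ∨ inner ℝ x y = -α

/-- Switching equivalence `G ≅ H` of real `k × k` matrices: `(C B)ᵀ G (C B) = H` for a permutation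
matrix `C` and a diagonal matrix `B` with diagonal entries `±1`. -/
def SwitchingEquivalent {k : ℕ} (G H : Matrix (Fin k) (Fin k) ℝ) : Prop :=
  ∃ (d : Fin k → ℝ) (σ : Equiv.Perm (Fin k)), (∀ i, d i = 1 ∨ d i = -1) ∧
    (σ.permMatrix ℝ * Matrix.diagonal d).transpose * G * (σ.permMatrix ℝ * Matrix.diagonal d) = H

/-- The `k × k` matrix `(1 + α) I - α J`, where `J` is the all-one matrix. -/
def negCliqueGram (α : ℝ) (k : ℕ) : Matrix (Fin k) (Fin k) ℝ :=
  (1 + α) • (1 : Matrix (Fin k) (Fin k) ℝ) - α • Matrix.of (fun _ _ => (1 : ℝ))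

/-- The positive integers `k` for which some `p₁, …, p_k ∈ X` have a Gram matrix that is switching
equivalent to `(1 + α) I - α J`. -/
def baseSizes {r : ℕ} (α : ℝ) (X : Finset (EuclideanSpace ℝ (Fin r))) : Set ℕ :=
  {k | 0 < k ∧ ∃ p : Fin k → EuclideanSpace ℝ (Fin r), (∀ i, p i ∈ X) ∧
    SwitchingEquivalent (Matrix.gram ℝ p) (negCliqueGram α k)}

/-- The base size `K_α(X)`: the largest element of `baseSizes α X`. For a nonempty equiangular `X`
this maximum exists, see `baseSize_isGreatest`. -/
noncomputable def baseSize {r : ℕ} (α : ℝ) (X : Finset (EuclideanSpace ℝ (Fin r))) : ℕ :=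
  sSup (baseSizes α X)

theorem switchingEquivalent_entry {k : ℕ} {G H : Matrix (Fin k) (Fin k) ℝ}
    (h : SwitchingEquivalent G H) : ∃ (d : Fin k → ℝ) (σ : Equiv.Perm (Fin k)),
    (∀ i, d i = 1 ∨ d i = -1) ∧ ∀ i j, H i j = d i * d j * G (σ i) (σ j) := by
  obtain ⟨d, σ, hd, rfl⟩ := h
  refine ⟨d, σ.symm, hd, fun i j => ?_⟩
  have h : (σ.permMatrix ℝ * Matrix.diagonal d).transpose * G * (σ.permMatrix ℝ * Matrix.diagonal d)
      = Matrix.diagonal d * G.submatrix σ.symm σ.symm * Matrix.diagonal d := by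
    rw [Matrix.transpose_mul, Matrix.diagonal_transpose, Matrix.transpose_permMatrix]
    simp only [Equiv.Perm.permMatrix, Matrix.mul_assoc]
    rw [← Matrix.mul_assoc G, PEquiv.mul_toMatrix_toPEquiv,
      ← Matrix.mul_assoc (PEquiv.toMatrix _), PEquiv.toMatrix_toPEquiv_mul]
    rfl
  rw [h, Matrix.mul_diagonal, Matrix.diagonal_mul, Matrix.submatrix_apply]
  ring

theorem baseSize_isGreatest {r : ℕ} {α : ℝ} {X : Finset (EuclideanSpace ℝ (Fin r))}
    (hX : IsEquiangular α X) (hne : X.Nonempty) : IsGreatest (baseSizes α X) (baseSize α X) := by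
  obtain ⟨hα0, hα1, hunit, -⟩ := hX
  have hbdd : BddAbove (baseSizes α X) := by
    refine ⟨X.card, ?_⟩
    rintro k ⟨-, p, hp, hG⟩
    obtain ⟨d, σ, hd, hent⟩ := switchingEquivalent_entry hG
    have hinj : Function.Injective p := by
      intro a b hab
      by_contra hne
      have h := hent (σ.symm a) (σ.symm b)
      have hne' : σ.symm a ≠ σ.symm b := fun h => hne (σ.symm.injective h)
      simp only [negCliqueGram, Matrix.sub_apply, Matrix.smul_apply, Matrix.one_apply_ne hne',
        Matrix.of_apply, Matrix.gram_apply, Equiv.apply_symm_apply, hab, hunit _ (hp b),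
        smul_eq_mul] at h
      rcases hd (σ.symm a) with h1 | h1 <;> rcases hd (σ.symm b) with h2 | h2 <;>
        rw [h1, h2] at h <;> linarith
    simpa using Finset.card_le_card_of_injOn (s := Finset.univ) (t := X) p
      (fun i _ => hp i) hinj.injOn
  have hmem : (baseSizes α X).Nonempty := by
    obtain ⟨x, hx⟩ := hne
    refine ⟨1, one_pos, fun _ => x, fun _ => hx, fun _ => 1, 1, fun _ => Or.inl rfl, ?_⟩
    ext i j
    have : i = j := Subsingleton.elim _ _
    subst this
    have hG : Matrix.gram ℝ (fun _ : Fin 1 => x) = 1 := by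
      ext a b
      rw [Subsingleton.elim a b, Matrix.gram_apply, Matrix.one_apply_eq, hunit x hx]
    simp [negCliqueGram, hG]
  exact ⟨Nat.sSup_mem hmem hbdd, fun k hk => le_csSup hbdd hk⟩

/-! ### Unit vectors with nonpositive inner products -/

section ObtuseSystems

variable {E : Type*} [NormedAddCommGroup E] [InnerProductSpace ℝ E]
  {ι κ : Type*} [Fintype ι] [Fintype κ]

/-! Fix a base of five vectors, signed so that its Gram matrix is `(6/5) I - (1/5) J`, and project
the rest of `X` onto its orthogonal complement, of dimension `r - 5`. Up to sign each vector is
negative on at most two base vectors. Those negative on at most one have projections so obtuse that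
at most five exist.

The others fall into ten pillars, one per pair of base vectors. Rescaled projections are unit
vectors with inner products `0, -1/2` inside a pillar and, up to a global sign, `1/6, -1/3` across
two pillars. Rank-trace bounds one pillar by `3(r - 5)/2` (`two_mul_card_le`), and two pillars of
sizes `a, b` satisfy `b (a - 27) ≤ 48` (`card_mul_card_le`). So either one pillar is alone, or the
pillars total at most `280`. Adding five exceptional vectors and five base vectors gives `|X| ≤ 290`
or `2|X| ≤ 3r + 5`. -/

theorem inner_sum_smul_self (u : ι → E) (c : ι → ℝ) :
    inner ℝ (∑ i, c i • u i) (∑ i, c i • u i) = ∑ i, ∑ j, c i * c j * inner ℝ (u i) (u j) := by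
  simp only [sum_inner, inner_sum, real_inner_smul_left, real_inner_smul_right]
  refine Finset.sum_congr rfl fun i _ => Finset.sum_congr rfl fun j _ => ?_
  rw [real_inner_comm (u i)]
  ring

/-- The Gram matrix of unit vectors with nonpositive mutual inner products is bounded by `2`. -/
theorem inner_sum_smul_self_le {u : ι → E} (h1 : ∀ i, inner ℝ (u i) (u i) = 1)
    (h2 : ∀ i j, i ≠ j → inner ℝ (u i) (u j) ≤ 0) (c : ι → ℝ) :
    inner ℝ (∑ i, c i • u i) (∑ i, c i • u i) ≤ 2 * ∑ i, c i ^ 2 := by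
  classical
  -- Off the diagonal, the quadratic forms at `c` and `|c|` have nonpositive sum, so only the
  -- diagonal survives.
  have h0 : 0 ≤ inner ℝ (∑ i, |c i| • u i) (∑ i, |c i| • u i) := real_inner_self_nonneg
  have key : ∑ i, ∑ j, c i * c j * inner ℝ (u i) (u j)
      + ∑ i, ∑ j, |c i| * |c j| * inner ℝ (u i) (u j) ≤ ∑ i, ∑ j, if i = j then 2 * c i ^ 2 else 0 := by
    simp only [← Finset.sum_add_distrib]
    refine Finset.sum_le_sum fun i _ => Finset.sum_le_sum fun j _ => ?_
    split_ifs with h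
    · subst h
      rw [h1, abs_mul_abs_self]
      linarith
    · have := neg_abs_le (c i * c j)
      rw [abs_mul] at this
      nlinarith [h2 i j h]
  simp only [Finset.sum_ite_eq, Finset.mem_univ, if_true, ← Finset.mul_sum] at key
  rw [inner_sum_smul_self] at h0 ⊢
  linarith

/-- The frame operator has the same norm bound `2` as the Gram matrix. -/
theorem sum_inner_sq_le {u : ι → E} (h1 : ∀ i, inner ℝ (u i) (u i) = 1)
    (h2 : ∀ i j, i ≠ j → inner ℝ (u i) (u j) ≤ 0) (y : E) :
    ∑ i, inner ℝ (u i) y ^ 2 ≤ 2 * inner ℝ y y := by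
  have hg := inner_sum_smul_self_le h1 h2 fun i => inner ℝ (u i) y
  have hgy : inner ℝ (∑ i, inner ℝ (u i) y • u i) y = ∑ i, inner ℝ (u i) y ^ 2 := by
    simp only [sum_inner, real_inner_smul_left, sq]
  have h0 := real_inner_self_nonneg (F := E) (x := ∑ i, inner ℝ (u i) y • u i - (2 : ℝ) • y)
  rw [inner_sub_left, inner_sub_right, inner_sub_right, real_inner_smul_left, real_inner_smul_left,
    real_inner_smul_right, real_inner_smul_right, real_inner_comm _ y, hgy] at h0
  linarith

theorem inner_sum_self_le_card {u : ι → E} (h1 : ∀ i, inner ℝ (u i) (u i) = 1)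
    (h2 : ∀ i j, i ≠ j → inner ℝ (u i) (u j) ≤ 0) :
    inner ℝ (∑ i, u i) (∑ i, u i) ≤ Fintype.card ι := by
  classical
  have : ∑ i, ∑ j, inner ℝ (u i) (u j) ≤ ∑ i : ι, ∑ j : ι, if i = j then (1 : ℝ) else 0 :=
    Finset.sum_le_sum fun i _ => Finset.sum_le_sum fun j _ => by
      split_ifs with h
      · rw [← h, h1]
      · exact h2 i j h
  rw [sum_inner]
  simp only [inner_sum]
  simpa using this

/-- Few vectors of bounded norm can have uniformly negative mutual inner products. -/
theorem card_le_five_of_inner_le {u : ι → E} (h1 : ∀ i, inner ℝ (u i) (u i) ≤ 8 / 15)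
    (h2 : ∀ i j, i ≠ j → inner ℝ (u i) (u j) ≤ -(2 / 15)) : Fintype.card ι ≤ 5 := by
  classical
  have h0 : 0 ≤ inner ℝ (∑ i, u i) (∑ i, u i) := real_inner_self_nonneg
  have key : ∑ i, ∑ j, inner ℝ (u i) (u j)
      ≤ ∑ i : ι, ∑ j : ι, ((if i = j then (2 / 3 : ℝ) else 0) - 2 / 15) :=
    Finset.sum_le_sum fun i _ => Finset.sum_le_sum fun j _ => by
      split_ifs with h
      · rw [← h]
        linarith [h1 i]
      · linarith [h2 i j h]
  rw [sum_inner] at h0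
  simp only [inner_sum] at h0
  simp only [Finset.sum_sub_distrib, Finset.sum_ite_eq, Finset.mem_univ, if_true,
    Finset.sum_const, Finset.card_univ, nsmul_eq_mul] at key
  by_contra! h
  have h6 : (6 : ℝ) ≤ Fintype.card ι := by exact_mod_cast h
  nlinarith

/-- The rank-trace inequality `(tr G)² ≤ rank G · tr G²` for a Gram matrix `G`. -/
theorem sq_sum_inner_self_le [FiniteDimensional ℝ E] (u : ι → E) :
    (∑ i, inner ℝ (u i) (u i)) ^ 2 ≤ Module.finrank ℝ E * ∑ i, ∑ j, inner ℝ (u i) (u j) ^ 2 := by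
  let b := stdOrthonormalBasis ℝ E
  -- The matrix of the frame operator: it shares trace and Frobenius norm with the Gram matrix but
  -- has size `finrank`, so Cauchy–Schwarz on its diagonal suffices.
  let t (k l : Fin (Module.finrank ℝ E)) : ℝ := ∑ i, inner ℝ (u i) (b k) * inner ℝ (u i) (b l)
  have hin (x y : E) : inner ℝ x y = ∑ k, inner ℝ x (b k) * inner ℝ y (b k) := by
    rw [← b.sum_inner_mul_inner x y]
    simp only [real_inner_comm y]
  have htr : ∑ i, inner ℝ (u i) (u i) = ∑ k, t k k := by
    simp only [hin (u _) (u _)]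
    exact Finset.sum_comm
  have hsq : ∑ i, ∑ j, inner ℝ (u i) (u j) ^ 2 = ∑ k, ∑ l, t k l ^ 2 := by
    simp only [hin (u _) (u _), t, sq, Finset.sum_mul_sum]
    rw [Finset.sum_congr rfl fun i _ => Finset.sum_comm, Finset.sum_comm]
    refine Finset.sum_congr rfl fun k _ => ?_
    rw [Finset.sum_congr rfl fun i _ => Finset.sum_comm, Finset.sum_comm]
    refine Finset.sum_congr rfl fun l _ => Finset.sum_congr rfl fun i _ =>
      Finset.sum_congr rfl fun j _ => by ring
  rw [htr, hsq]
  have hcs := sq_sum_le_card_mul_sum_sq (s := Finset.univ) (f := fun k => t k k)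
  rw [Finset.card_univ, Fintype.card_fin] at hcs
  refine hcs.trans (mul_le_mul_of_nonneg_left (Finset.sum_le_sum fun k _ => ?_) (Nat.cast_nonneg _))
  exact Finset.single_le_sum (f := fun l => t k l ^ 2) (fun _ _ => sq_nonneg _) (Finset.mem_univ k)

/-- Off-diagonal Gram entries satisfy `g² = -g/2`, so `tr G² = 3n/2 - |∑ u|²/2 ≤ 3n/2`; combine with
`n² ≤ rank G · tr G²`. -/
theorem two_mul_card_le [FiniteDimensional ℝ E] {u : ι → E} (h1 : ∀ i, inner ℝ (u i) (u i) = 1)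
    (h2 : ∀ i j, i ≠ j → inner ℝ (u i) (u j) = 0 ∨ inner ℝ (u i) (u j) = -(1 / 2)) :
    2 * Fintype.card ι ≤ 3 * Module.finrank ℝ E := by
  classical
  have h0 : 0 ≤ inner ℝ (∑ i, u i) (∑ i, u i) := real_inner_self_nonneg
  rw [sum_inner] at h0
  simp only [inner_sum] at h0
  have hrk := sq_sum_inner_self_le u
  have key : ∑ i, ∑ j, inner ℝ (u i) (u j) ^ 2
      = ∑ i, ∑ j, ((if i = j then (3 / 2 : ℝ) else 0) - 1 / 2 * inner ℝ (u i) (u j)) :=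
    Finset.sum_congr rfl fun i _ => Finset.sum_congr rfl fun j _ => by
      split_ifs with h
      · rw [← h, h1]
        norm_num
      · rcases h2 i j h with h | h <;> rw [h] <;> norm_num
  simp only [Finset.sum_sub_distrib, ← Finset.mul_sum, Finset.sum_ite_eq, Finset.mem_univ, if_true,
    Finset.sum_const, Finset.card_univ, nsmul_eq_mul] at key
  simp only [h1, Finset.sum_const, Finset.card_univ, nsmul_eq_mul, mul_one] at hrk
  rcases Nat.eq_zero_or_pos (Fintype.card ι) with hc | hc
  · omega
  have hc' : (0 : ℝ) < Fintype.card ι := by exact_mod_cast hc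
  have hn : (0 : ℝ) ≤ Module.finrank ℝ E := Nat.cast_nonneg _
  have : (2 : ℝ) * Fintype.card ι ≤ 3 * Module.finrank ℝ E := by
    refine le_of_mul_le_mul_right ?_ hc'
    nlinarith [mul_nonneg hn h0]
  exact_mod_cast this

/-- Linearizes `|x - ∑ (f i / 9) u i|² ≥ 0`, where `f i = 6⟨x, u i⟩`, so that it can be summed over
many `x`. The divisor `9` makes the terms in `∑ f i` cancel. -/
theorem inner_sum_inner_smul_bound {u : ι → E} (h1 : ∀ i, inner ℝ (u i) (u i) = 1)
    (h2 : ∀ i j, i ≠ j → inner ℝ (u i) (u j) = 0 ∨ inner ℝ (u i) (u j) = -(1 / 2))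
    {x : E} (hx : inner ℝ x x = 1)
    (hxu : ∀ i, inner ℝ x (u i) = 1 / 6 ∨ inner ℝ x (u i) = -(1 / 3)) :
    (Fintype.card ι : ℝ) + inner ℝ (∑ i, u i) (∑ i, u i) / 3
      ≤ 27 + 4 * inner ℝ x (∑ i, inner ℝ (u i) (∑ j, u j) • u i) := by
  classical
  set f : ι → ℝ := fun i => 6 * inner ℝ x (u i) with hf
  have hf' : ∀ i, f i = 1 ∨ f i = -2 := fun i => by
    rcases hxu i with h | h <;> simp only [hf, h] <;> norm_num
  have h0 := real_inner_self_nonneg (F := E) (x := x - ∑ i, (f i / 9) • u i)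
  have hxy : inner ℝ x (∑ i, (f i / 9) • u i) = ∑ i, f i ^ 2 / 54 := by
    simp only [inner_sum, real_inner_smul_right]
    exact Finset.sum_congr rfl fun i _ => by simp only [hf]; ring
  rw [inner_sub_left, inner_sub_right, inner_sub_right, real_inner_comm x (∑ i, _), hxy, hx,
    inner_sum_smul_self] at h0
  -- Since `f ≤ 1`, `f i * f j ≥ f i + f j - 1`, and off-diagonal inner products are nonpositive. On
  -- the diagonal `f² = 2 - f`.
  have hle : ∑ i, ∑ j, f i / 9 * (f j / 9) * inner ℝ (u i) (u j)
      ≤ ∑ i, ∑ j, ((if i = j then (3 - 3 * f i) / 81 else 0)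
        + (f i + f j - 1) / 81 * inner ℝ (u i) (u j)) := by
    refine Finset.sum_le_sum fun i _ => Finset.sum_le_sum fun j _ => ?_
    split_ifs with h
    · subst h
      rw [h1]
      rcases hf' i with h | h <;> rw [h] <;> norm_num
    · rcases h2 i j h with h | h <;> rw [h]
      · simp
      · rcases hf' i with h | h <;> rcases hf' j with h' | h' <;> rw [h, h'] <;> norm_num
  have hS : ∑ i, ∑ j, inner ℝ (u i) (u j) = inner ℝ (∑ i, u i) (∑ i, u i) := by
    rw [sum_inner]
    simp only [inner_sum]
  have hg : ∑ i, ∑ j, f i * inner ℝ (u i) (u j)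
      = 6 * inner ℝ x (∑ i, inner ℝ (u i) (∑ j, u j) • u i) := by
    simp only [inner_sum, real_inner_smul_right, Finset.mul_sum, hf]
    exact Finset.sum_congr rfl fun i _ => by
      rw [Finset.sum_mul, Finset.mul_sum]
      exact Finset.sum_congr rfl fun j _ => by ring
  have hg' : ∑ i, ∑ j, f j * inner ℝ (u i) (u j) = ∑ i, ∑ j, f i * inner ℝ (u i) (u j) := by
    rw [Finset.sum_comm]
    simp only [real_inner_comm]
  have hsplit : ∑ i, ∑ j, (f i + f j - 1) / 81 * inner ℝ (u i) (u j)
      = (∑ i, ∑ j, f i * inner ℝ (u i) (u j) + ∑ i, ∑ j, f j * inner ℝ (u i) (u j)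
        - ∑ i, ∑ j, inner ℝ (u i) (u j)) / 81 := by
    simp only [← Finset.sum_add_distrib, ← Finset.sum_sub_distrib, Finset.sum_div]
    exact Finset.sum_congr rfl fun i _ => Finset.sum_congr rfl fun j _ => by ring
  have hdiag : ∑ i, (3 - 3 * f i) / 81 = (3 * Fintype.card ι - 3 * ∑ i, f i) / 81 := by
    rw [← Finset.sum_div, Finset.sum_sub_distrib, ← Finset.mul_sum]
    simp [mul_comm]
  have hsq : ∑ i, f i ^ 2 / 54 = (2 * Fintype.card ι - ∑ i, f i) / 54 := by
    have : ∀ i, f i ^ 2 = 2 - f i := fun i => by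
      rcases hf' i with h | h <;> rw [h] <;> norm_num
    simp only [this, ← Finset.sum_div, Finset.sum_sub_distrib]
    simp [mul_comm]
  simp only [Finset.sum_add_distrib, Finset.sum_ite_eq, Finset.mem_univ, if_true] at hle
  rw [hsplit, hg', hg, hS, hdiag] at hle
  rw [hsq] at h0
  linarith

/-- Two systems of unit vectors with inner products `0, -1/2` inside each system and `1/6, -1/3`
across cannot both be large. -/
theorem card_mul_card_le {u : ι → E} {v : κ → E} (h1 : ∀ i, inner ℝ (u i) (u i) = 1)
    (h2 : ∀ i j, i ≠ j → inner ℝ (u i) (u j) = 0 ∨ inner ℝ (u i) (u j) = -(1 / 2))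
    (h3 : ∀ i, inner ℝ (v i) (v i) = 1) (h4 : ∀ i j, i ≠ j → inner ℝ (v i) (v j) ≤ 0)
    (h5 : ∀ k i, inner ℝ (v k) (u i) = 1 / 6 ∨ inner ℝ (v k) (u i) = -(1 / 3)) :
    Fintype.card κ * Fintype.card ι ≤ 48 + 27 * Fintype.card κ := by
  have h2' : ∀ i j, i ≠ j → inner ℝ (u i) (u j) ≤ 0 := fun i j h => by
    rcases h2 i j h with h | h <;> rw [h] <;> norm_num
  rcases Nat.eq_zero_or_pos (Fintype.card κ) with hc | hc
  · simp [hc]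
  have hb : (0 : ℝ) < Fintype.card κ := by exact_mod_cast hc
  set S := ∑ i, u i
  set g := ∑ i, inner ℝ (u i) S • u i
  set z := ∑ k, v k
  have hz : inner ℝ z z ≤ Fintype.card κ := inner_sum_self_le_card h3 h4
  have hg : inner ℝ g g ≤ 4 * inner ℝ S S := by
    have := inner_sum_smul_self_le h1 h2' fun i => inner ℝ (u i) S
    linarith [sum_inner_sq_le h1 h2' S]
  have hsum := Finset.sum_le_sum fun k (_ : k ∈ Finset.univ) =>
    inner_sum_inner_smul_bound h1 h2 (h3 k) (h5 k)
  rw [Finset.sum_const, Finset.sum_add_distrib, ← Finset.mul_sum, ← sum_inner] at hsum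
  simp only [Finset.sum_const, Finset.card_univ, nsmul_eq_mul] at hsum
  change (Fintype.card κ : ℝ) * (Fintype.card ι + inner ℝ S S / 3)
    ≤ Fintype.card κ * 27 + 4 * inner ℝ z g at hsum
  -- The weight `24` makes the `|g|²` term, bounded by `4|S|²`, match the `|S|²/3` to be absorbed.
  have h0 := real_inner_self_nonneg (F := E) (x := (24 : ℝ) • z - (Fintype.card κ : ℝ) • g)
  rw [inner_sub_left, inner_sub_right, inner_sub_right, real_inner_comm (_ • z) (_ • g)] at h0
  simp only [real_inner_smul_left, real_inner_smul_right] at h0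
  have hzg : 4 * inner ℝ z g ≤ 48 + Fintype.card κ * inner ℝ S S / 3 := by
    refine le_of_mul_le_mul_left ?_ hb
    nlinarith [mul_le_mul_of_nonneg_left hg (mul_pos hb hb).le]
  have : (Fintype.card κ : ℝ) * Fintype.card ι ≤ 48 + 27 * Fintype.card κ := by linarith
  exact_mod_cast this

end ObtuseSystems

/-! ### Counting over ten pillars -/

/-- A pillar of size at least `29` forces the others to at most `24`; a nonempty other pillar caps
it at `75`, and one of size two caps it at `51`. The totals `75 + 9` and `51 + 216` stay below
`280`. -/
theorem sum_le_of_pairwise_mul_le {τ : Type*} {s : Finset τ} (hs : s.card = 10) {N : τ → ℕ} {M : ℕ}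
    (hM : ∀ t ∈ s, 2 * N t ≤ M)
    (h : ∀ t ∈ s, ∀ t' ∈ s, t ≠ t' → N t' * N t ≤ 48 + 27 * N t') :
    ∑ t ∈ s, N t ≤ 280 ∨ 2 * ∑ t ∈ s, N t ≤ M := by
  classical
  by_cases hall : ∀ t ∈ s, N t ≤ 28
  · left
    have := Finset.sum_le_card_nsmul s N 28 hall
    simpa [hs] using this
  push Not at hall
  obtain ⟨t, ht, hNt⟩ := hall
  have hcard : (s.erase t).card = 9 := by rw [Finset.card_erase_of_mem ht, hs]
  have hsum := Finset.add_sum_erase s N ht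
  have hpair : ∀ t' ∈ s.erase t, N t' * N t ≤ 48 + 27 * N t' := fun t' ht' =>
    h t ht t' (Finset.mem_of_mem_erase ht') (Finset.ne_of_mem_erase ht').symm
  by_cases h0 : ∀ t' ∈ s.erase t, N t' = 0
  · right
    rw [Finset.sum_eq_zero h0] at hsum
    have := hM t ht
    omega
  left
  push Not at h0
  obtain ⟨t₁, ht₁, hN₁⟩ := h0
  have hone : 1 ≤ N t₁ := Nat.one_le_iff_ne_zero.2 hN₁
  have h75 : N t ≤ 75 := by nlinarith [hpair t₁ ht₁]
  by_cases h2 : ∀ t' ∈ s.erase t, N t' ≤ 1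
  · have : ∑ x ∈ s.erase t, N x ≤ 9 * 1 := hcard ▸ Finset.sum_le_card_nsmul (s.erase t) N 1 h2
    omega
  push Not at h2
  obtain ⟨t₂, ht₂, hN₂⟩ := h2
  have h51 : N t ≤ 51 := by nlinarith [hpair t₂ ht₂]
  have h24 : ∀ t' ∈ s.erase t, N t' ≤ 24 := fun t' ht' => by nlinarith [hpair t' ht']
  have : ∑ x ∈ s.erase t, N x ≤ 9 * 24 := hcard ▸ Finset.sum_le_card_nsmul (s.erase t) N 24 h24
  omega

/-! ### Sign patterns on the base -/

/-- `signVec T` is `-1` on `T` and `1` elsewhere. -/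
def signVec (T : Finset (Fin 5)) (i : Fin 5) : ℤ := if i ∈ T then -1 else 1

/-- `30` times the inner product of the projections, to the span of the base, of two vectors with
sign patterns `S` and `T`. -/
def patternForm (S T : Finset (Fin 5)) : ℤ :=
  ∑ i, signVec S i * signVec T i + (∑ i, signVec S i) * ∑ i, signVec T i

set_option maxRecDepth 100000 in
theorem patternForm_self_of_card_two : ∀ T ∈ Finset.powersetCard 2 (Finset.univ : Finset (Fin 5)),
    patternForm T T = 6 := by
  decide

set_option maxRecDepth 100000 in
theorem patternForm_of_card_two : ∀ S ∈ Finset.powersetCard 2 (Finset.univ : Finset (Fin 5)),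
    ∀ T ∈ Finset.powersetCard 2 (Finset.univ : Finset (Fin 5)), S ≠ T →
    patternForm S T = 2 ∨ patternForm S T = -2 := by
  decide

set_option maxRecDepth 100000 in
theorem le_patternForm_self : ∀ T : Finset (Fin 5), T.card ≤ 1 → 14 ≤ patternForm T T := by
  decide

set_option maxRecDepth 100000 in
theorem le_patternForm : ∀ S : Finset (Fin 5), S.card ≤ 1 → ∀ T : Finset (Fin 5), T.card ≤ 1 →
    10 ≤ patternForm S T := by
  decide

set_option maxRecDepth 100000 in
theorem card_le_two_of_sum_signVec_nonneg :
    ∀ T : Finset (Fin 5), 0 ≤ ∑ i, signVec T i → T.card ≤ 2 := by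
  decide

/-! ### Projection away from the base, and pillars -/

section Pillars

variable {E : Type*} [NormedAddCommGroup E] [InnerProductSpace ℝ E]

/-- `p` is a base of size five for the angle `1 / 5`. -/
def IsBase (p : Fin 5 → E) : Prop :=
  ∀ i j, inner ℝ (p i) (p j) = (if i = j then (6 / 5 : ℝ) else 0) - 1 / 5

/-- The orthogonal projection of `x` to the orthogonal complement of a base `p`. -/
noncomputable def baseResidual (p : Fin 5 → E) (x : E) : E :=
  -- The inverse of `(6/5) I - (1/5) J` is `(5/6)(I + J)`.
  x - (5 / 6 : ℝ) • ∑ i, (inner ℝ x (p i) + ∑ j, inner ℝ x (p j)) • p i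

theorem inner_baseResidual_base {p : Fin 5 → E} (hp : IsBase p) (x : E) (k : Fin 5) :
    inner ℝ (baseResidual p x) (p k) = 0 := by
  simp only [baseResidual, inner_sub_left, real_inner_smul_left, sum_inner, hp _ k, mul_sub,
    Finset.sum_sub_distrib, mul_ite, mul_zero, Finset.sum_ite_eq', Finset.mem_univ, if_true,
    ← Finset.sum_mul, Finset.sum_add_distrib, Finset.sum_const, Finset.card_univ, Fintype.card_fin]
  ring

theorem inner_baseResidual_residual {p : Fin 5 → E} (hp : IsBase p) (x y : E) :
    inner ℝ (baseResidual p x) (baseResidual p y) = inner ℝ x y - 5 / 6 *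
      (∑ i, inner ℝ x (p i) * inner ℝ y (p i)
        + (∑ i, inner ℝ x (p i)) * ∑ i, inner ℝ y (p i)) := by
  have h : inner ℝ (baseResidual p x) (baseResidual p y) = inner ℝ (baseResidual p x) y := by
    conv_lhs => rw [baseResidual.eq_def p y]
    simp only [inner_sub_right, real_inner_smul_right, inner_sum, inner_baseResidual_base hp, mul_zero,
      Finset.sum_const_zero, sub_zero]
  rw [h]
  simp only [baseResidual, inner_sub_left, real_inner_smul_left, sum_inner, real_inner_comm _ (p _),
    add_mul, Finset.sum_add_distrib, Finset.mul_sum]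

theorem inner_baseResidual_of_signVec {p : Fin 5 → E} (hp : IsBase p) {x y : E} {S T : Finset (Fin 5)}
    (hx : ∀ i, inner ℝ x (p i) = signVec S i / 5) (hy : ∀ i, inner ℝ y (p i) = signVec T i / 5) :
    inner ℝ (baseResidual p x) (baseResidual p y) = inner ℝ x y - patternForm S T / 30 := by
  rw [inner_baseResidual_residual hp, patternForm]
  simp only [hx, hy]
  push_cast
  rw [← Finset.sum_div, ← Finset.sum_div]
  have : ∑ i, (signVec S i : ℝ) / 5 * (signVec T i / 5)
      = (∑ i, (signVec S i : ℝ) * signVec T i) / 25 := by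
    rw [Finset.sum_div]
    exact Finset.sum_congr rfl fun i _ => by ring
  rw [this]
  ring

theorem IsBase.linearIndependent {p : Fin 5 → E} (hp : IsBase p) : LinearIndependent ℝ p := by
  rw [Fintype.linearIndependent_iff]
  intro g hg
  have h : ∀ k, 6 / 5 * g k = 1 / 5 * ∑ i, g i := fun k => by
    have h0 : inner ℝ (∑ i, g i • p i) (p k) = 0 := by rw [hg, inner_zero_left]
    simp only [sum_inner, real_inner_smul_left, hp _ k, mul_sub, Finset.sum_sub_distrib, mul_ite,
      mul_zero, Finset.sum_ite_eq', Finset.mem_univ, if_true, ← Finset.sum_mul] at h0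
    linarith
  have hs := Finset.sum_congr rfl fun k (_ : k ∈ Finset.univ) => h k
  rw [← Finset.mul_sum, Finset.sum_const, Finset.card_univ, Fintype.card_fin, nsmul_eq_mul] at hs
  push_cast at hs
  intro i
  linarith [h i]

/-- The one of `x`, `-x` whose inner products with the base have nonnegative sum. -/
noncomputable def switched (p : Fin 5 → E) (x : E) : E :=
  if 0 ≤ ∑ i, inner ℝ x (p i) then x else -x

/-- The base vectors that make a negative inner product with `switched p x`. -/
noncomputable def negSet (p : Fin 5 → E) (x : E) : Finset (Fin 5) :=
  Finset.univ.filter fun i => inner ℝ (switched p x) (p i) < 0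

theorem switched_eq_or (p : Fin 5 → E) (x : E) : switched p x = x ∨ switched p x = -x := by
  unfold switched
  split_ifs <;> simp

theorem inner_switched_self (p : Fin 5 → E) (x : E) :
    inner ℝ (switched p x) (switched p x) = inner ℝ x x := by
  rcases switched_eq_or p x with h | h <;> simp only [h, inner_neg_neg]

theorem inner_switched_or {p : Fin 5 → E} {x y : E}
    (h : inner ℝ x y = 1 / 5 ∨ inner ℝ x y = -(1 / 5)) :
    inner ℝ (switched p x) (switched p y) = 1 / 5
      ∨ inner ℝ (switched p x) (switched p y) = -(1 / 5) := by
  rcases switched_eq_or p x with hx | hx <;> rcases switched_eq_or p y with hy | hy <;>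
    rcases h with h | h <;> simp [hx, hy, h]

theorem inner_switched_base {p : Fin 5 → E} {x : E}
    (h : ∀ i, inner ℝ x (p i) = 1 / 5 ∨ inner ℝ x (p i) = -(1 / 5)) (i : Fin 5) :
    inner ℝ (switched p x) (p i) = signVec (negSet p x) i / 5 := by
  have h' : inner ℝ (switched p x) (p i) = 1 / 5 ∨ inner ℝ (switched p x) (p i) = -(1 / 5) := by
    rcases switched_eq_or p x with hx | hx <;> rw [hx]
    · exact h i
    · rw [inner_neg_left]
      rcases h i with h | h <;> rw [h] <;> norm_num
  rcases h' with h' | h' <;> simp only [signVec, negSet, Finset.mem_filter, h'] <;> norm_num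

theorem card_negSet_le {p : Fin 5 → E} {x : E}
    (h : ∀ i, inner ℝ x (p i) = 1 / 5 ∨ inner ℝ x (p i) = -(1 / 5)) : (negSet p x).card ≤ 2 := by
  refine card_le_two_of_sum_signVec_nonneg _ ?_
  have h0 : 0 ≤ ∑ i, inner ℝ (switched p x) (p i) := by
    unfold switched
    split_ifs with hs
    · exact hs
    · simp only [inner_neg_left, Finset.sum_neg_distrib]
      linarith
  simp only [inner_switched_base h, ← Finset.sum_div] at h0
  have : (0 : ℝ) ≤ ∑ i, (signVec (negSet p x) i : ℝ) := by linarith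
  exact_mod_cast this

/-- The residual of `x` after switching, normalized to be a unit vector when `negSet p x` has two
elements. -/
noncomputable def pillarVec (p : Fin 5 → E) (x : E) : E :=
  √(5 / 4) • baseResidual p (switched p x)

theorem inner_pillarVec {p : Fin 5 → E} (hp : IsBase p) {x y : E}
    (hx : ∀ i, inner ℝ x (p i) = 1 / 5 ∨ inner ℝ x (p i) = -(1 / 5))
    (hy : ∀ i, inner ℝ y (p i) = 1 / 5 ∨ inner ℝ y (p i) = -(1 / 5)) :
    inner ℝ (pillarVec p x) (pillarVec p y)
      = 5 / 4 * (inner ℝ (switched p x) (switched p y)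
        - patternForm (negSet p x) (negSet p y) / 30) := by
  rw [pillarVec, pillarVec, real_inner_smul_left, real_inner_smul_right, ← mul_assoc,
    Real.mul_self_sqrt (by norm_num),
    inner_baseResidual_of_signVec hp (inner_switched_base hx) (inner_switched_base hy)]

variable {p : Fin 5 → E} {Y : Finset E}

/-- The residuals have square norm at most `1 - 14/30 = 8/15` and inner products at most `1/5 -
10/30 = -2/15`. -/
theorem card_filter_negSet_le_one (hp : IsBase p) (h1 : ∀ x ∈ Y, inner ℝ x x = 1)
    (h2 : ∀ x ∈ Y, ∀ y ∈ Y, x ≠ y → inner ℝ x y = 1 / 5 ∨ inner ℝ x y = -(1 / 5))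
    (h3 : ∀ x ∈ Y, ∀ i, inner ℝ x (p i) = 1 / 5 ∨ inner ℝ x (p i) = -(1 / 5)) :
    (Y.filter fun x => (negSet p x).card ≤ 1).card ≤ 5 := by
  rw [← Fintype.card_coe]
  refine card_le_five_of_inner_le
    (u := fun x : (Y.filter fun x => (negSet p x).card ≤ 1) => baseResidual p (switched p x.1)) ?_ ?_
  · rintro ⟨x, hx⟩
    rw [Finset.mem_filter] at hx
    have hb := inner_switched_base (h3 x hx.1)
    have h14 : (14 : ℝ) ≤ patternForm (negSet p x) (negSet p x) := by
      exact_mod_cast le_patternForm_self _ hx.2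
    rw [inner_baseResidual_of_signVec hp hb hb, inner_switched_self, h1 x hx.1]
    linarith
  · rintro ⟨x, hx⟩ ⟨y, hy⟩ hxy
    rw [Finset.mem_filter] at hx hy
    have h10 : (10 : ℝ) ≤ patternForm (negSet p x) (negSet p y) := by
      exact_mod_cast le_patternForm _ hx.2 _ hy.2
    have := inner_switched_or (p := p) (h2 x hx.1 y hy.1 fun h => hxy (Subtype.ext h))
    rw [inner_baseResidual_of_signVec hp (inner_switched_base (h3 x hx.1))
      (inner_switched_base (h3 y hy.1))]
    rcases this with h | h <;> rw [h] <;> linarith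

theorem inner_pillarVec_self (hp : IsBase p) (h1 : ∀ x ∈ Y, inner ℝ x x = 1)
    (h3 : ∀ x ∈ Y, ∀ i, inner ℝ x (p i) = 1 / 5 ∨ inner ℝ x (p i) = -(1 / 5))
    {T : Finset (Fin 5)} (hT : T ∈ Finset.powersetCard 2 Finset.univ)
    (x : Y.filter fun x => negSet p x = T) :
    inner ℝ (pillarVec p x.1) (pillarVec p x.1) = 1 := by
  obtain ⟨x, hx⟩ := x
  obtain ⟨hxY, rfl⟩ := Finset.mem_filter.1 hx
  rw [inner_pillarVec hp (h3 x hxY) (h3 x hxY), inner_switched_self, h1 x hxY,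
    patternForm_self_of_card_two _ hT]
  norm_num

theorem inner_pillarVec_of_ne (hp : IsBase p)
    (h2 : ∀ x ∈ Y, ∀ y ∈ Y, x ≠ y → inner ℝ x y = 1 / 5 ∨ inner ℝ x y = -(1 / 5))
    (h3 : ∀ x ∈ Y, ∀ i, inner ℝ x (p i) = 1 / 5 ∨ inner ℝ x (p i) = -(1 / 5))
    {T : Finset (Fin 5)} (hT : T ∈ Finset.powersetCard 2 Finset.univ)
    (x y : Y.filter fun x => negSet p x = T) (hxy : x ≠ y) :
    inner ℝ (pillarVec p x.1) (pillarVec p y.1) = 0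
      ∨ inner ℝ (pillarVec p x.1) (pillarVec p y.1) = -(1 / 2) := by
  obtain ⟨x, hx⟩ := x
  obtain ⟨y, hy⟩ := y
  obtain ⟨hxY, rfl⟩ := Finset.mem_filter.1 hx
  obtain ⟨hyY, hyT⟩ := Finset.mem_filter.1 hy
  have := inner_switched_or (p := p) (h2 x hxY y hyY fun h => hxy (Subtype.ext h))
  rw [inner_pillarVec hp (h3 x hxY) (h3 y hyY), hyT, patternForm_self_of_card_two _ hT]
  rcases this with h | h <;> rw [h] <;> norm_num

theorem card_pillar_mul_card_pillar_le (hp : IsBase p) (h1 : ∀ x ∈ Y, inner ℝ x x = 1)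
    (h2 : ∀ x ∈ Y, ∀ y ∈ Y, x ≠ y → inner ℝ x y = 1 / 5 ∨ inner ℝ x y = -(1 / 5))
    (h3 : ∀ x ∈ Y, ∀ i, inner ℝ x (p i) = 1 / 5 ∨ inner ℝ x (p i) = -(1 / 5))
    {S T : Finset (Fin 5)} (hS : S ∈ Finset.powersetCard 2 Finset.univ)
    (hT : T ∈ Finset.powersetCard 2 Finset.univ) (hST : S ≠ T) :
    (Y.filter fun x => negSet p x = T).card * (Y.filter fun x => negSet p x = S).card
      ≤ 48 + 27 * (Y.filter fun x => negSet p x = T).card := by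
  rw [← Fintype.card_coe (Y.filter fun x => negSet p x = T),
    ← Fintype.card_coe (Y.filter fun x => negSet p x = S)]
  have hu1 := inner_pillarVec_self hp h1 h3 hS
  have hu2 := inner_pillarVec_of_ne hp h2 h3 hS
  have hv1 := inner_pillarVec_self hp h1 h3 hT
  have hv2 : ∀ x y : (Y.filter fun x => negSet p x = T), x ≠ y →
      inner ℝ (pillarVec p x.1) (pillarVec p y.1) ≤ 0 := fun x y hxy => by
    rcases inner_pillarVec_of_ne hp h2 h3 hT x y hxy with h | h <;> rw [h] <;> norm_num
  have hcross : ∀ (y : Y.filter fun x => negSet p x = T) (x : Y.filter fun x => negSet p x = S),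
      inner ℝ (pillarVec p y.1) (pillarVec p x.1)
        = 5 / 4 * (1 / 5 - (patternForm T S : ℝ) / 30) ∨
      inner ℝ (pillarVec p y.1) (pillarVec p x.1)
        = 5 / 4 * (-(1 / 5) - (patternForm T S : ℝ) / 30) := by
    rintro ⟨y, hy⟩ ⟨x, hx⟩
    obtain ⟨hyY, rfl⟩ := Finset.mem_filter.1 hy
    obtain ⟨hxY, rfl⟩ := Finset.mem_filter.1 hx
    have hne : y ≠ x := fun h => hST (by rw [h])
    rw [inner_pillarVec hp (h3 y hyY) (h3 x hxY)]
    rcases inner_switched_or (p := p) (h2 y hyY x hxY hne) with h | h <;> rw [h] <;> simp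
  rcases patternForm_of_card_two T hT S hS hST.symm with hN | hN
  · refine card_mul_card_le hu1 hu2 hv1 hv2 fun y x => ?_
    rcases hcross y x with h | h <;> rw [h, hN] <;> norm_num
  -- Here the cross inner products are `1/3, -1/6`; negating one pillar restores `-1/3, 1/6`.
  · refine card_mul_card_le (v := fun y : Y.filter fun x => negSet p x = T => -pillarVec p y.1)
      hu1 hu2 (fun y => by rw [inner_neg_neg, hv1])
      (fun x y hxy => by rw [inner_neg_neg]; exact hv2 x y hxy) fun y x => ?_
    rw [inner_neg_left]
    rcases hcross y x with h | h <;> rw [h, hN] <;> norm_num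

theorem two_mul_card_pillar_le [FiniteDimensional ℝ E] (hp : IsBase p)
    (h1 : ∀ x ∈ Y, inner ℝ x x = 1)
    (h2 : ∀ x ∈ Y, ∀ y ∈ Y, x ≠ y → inner ℝ x y = 1 / 5 ∨ inner ℝ x y = -(1 / 5))
    (h3 : ∀ x ∈ Y, ∀ i, inner ℝ x (p i) = 1 / 5 ∨ inner ℝ x (p i) = -(1 / 5))
    {T : Finset (Fin 5)} (hT : T ∈ Finset.powersetCard 2 Finset.univ) :
    2 * (Y.filter fun x => negSet p x = T).card
      ≤ 3 * Module.finrank ℝ (Submodule.span ℝ (Set.range p))ᗮ := by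
  rw [← Fintype.card_coe]
  have hmem (x : E) : pillarVec p x ∈ (Submodule.span ℝ (Set.range p))ᗮ := by
    refine Submodule.smul_mem _ _ ?_
    rw [Submodule.mem_orthogonal']
    intro y hy
    induction hy using Submodule.span_induction with
    | mem y hy =>
      obtain ⟨k, rfl⟩ := hy
      exact inner_baseResidual_base hp (switched p x) k
    | zero => exact inner_zero_right _
    | add y z _ _ hy hz => rw [inner_add_right, hy, hz, add_zero]
    | smul c y _ hy => rw [real_inner_smul_right, hy, mul_zero]
  exact two_mul_card_le (u := fun x : Y.filter fun x => negSet p x = T => ⟨_, hmem x.1⟩)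
    (inner_pillarVec_self hp h1 h3 hT) (inner_pillarVec_of_ne hp h2 h3 hT)

theorem IsBase.finrank_orthogonal [FiniteDimensional ℝ E] (hp : IsBase p) :
    Module.finrank ℝ (Submodule.span ℝ (Set.range p))ᗮ + 5 = Module.finrank ℝ E := by
  have h := Submodule.finrank_add_finrank_orthogonal (Submodule.span ℝ (Set.range p))
  rw [finrank_span_eq_card hp.linearIndependent, Fintype.card_fin] at h
  omega

theorem card_le_of_isBase [FiniteDimensional ℝ E] (hp : IsBase p)
    (h1 : ∀ x ∈ Y, inner ℝ x x = 1)
    (h2 : ∀ x ∈ Y, ∀ y ∈ Y, x ≠ y → inner ℝ x y = 1 / 5 ∨ inner ℝ x y = -(1 / 5))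
    (h3 : ∀ x ∈ Y, ∀ i, inner ℝ x (p i) = 1 / 5 ∨ inner ℝ x (p i) = -(1 / 5)) :
    Y.card ≤ 285 ∨ 2 * Y.card + 5 ≤ 3 * Module.finrank ℝ E := by
  have hsmall := card_filter_negSet_le_one hp h1 h2 h3
  have hsplit := Y.card_filter_add_card_filter_not fun x => (negSet p x).card ≤ 1
  have hmaps : ∀ x ∈ Y.filter fun x => ¬(negSet p x).card ≤ 1,
      negSet p x ∈ Finset.powersetCard 2 (Finset.univ : Finset (Fin 5)) := fun x hx => by
    rw [Finset.mem_filter] at hx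
    have := card_negSet_le (h3 x hx.1)
    exact Finset.mem_powersetCard.2 ⟨Finset.subset_univ _, by omega⟩
  have hfib := Finset.card_eq_sum_card_fiberwise hmaps
  have hle : ∑ T ∈ Finset.powersetCard 2 (Finset.univ : Finset (Fin 5)),
      ((Y.filter fun x => ¬(negSet p x).card ≤ 1).filter fun x => negSet p x = T).card
      ≤ ∑ T ∈ Finset.powersetCard 2 (Finset.univ : Finset (Fin 5)),
        (Y.filter fun x => negSet p x = T).card :=
    Finset.sum_le_sum fun T _ =>
      Finset.card_le_card (Finset.filter_subset_filter _ (Finset.filter_subset _ _))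
  have hcount := sum_le_of_pairwise_mul_le (s := Finset.powersetCard 2 (Finset.univ : Finset (Fin 5)))
    (by decide) (fun T hT => two_mul_card_pillar_le hp h1 h2 h3 hT)
    fun S hS T hT hST => card_pillar_mul_card_pillar_le hp h1 h2 h3 hS hT hST
  have hdim := hp.finrank_orthogonal
  omega

end Pillars

/-! ### Assembling the bound -/

theorem card_le_of_five_mem_baseSizes {r : ℕ} {X : Finset (EuclideanSpace ℝ (Fin r))}
    (hX : IsEquiangular (1 / 5) X) (h5 : 5 ∈ baseSizes (1 / 5) X) :
    X.card ≤ 290 ∨ 2 * X.card ≤ 3 * r + 5 := by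
  classical
  obtain ⟨-, -, hunit, hpair⟩ := hX
  obtain ⟨-, q, hq, hG⟩ := h5
  obtain ⟨d, σ, hd, hent⟩ := switchingEquivalent_entry hG
  have hp : IsBase fun i => d i • q (σ i) := fun i j => by
    have h := hent i j
    rw [Matrix.gram_apply] at h
    rw [real_inner_smul_left, real_inner_smul_right, ← mul_assoc, ← h]
    simp only [negCliqueGram, Matrix.sub_apply, Matrix.smul_apply, Matrix.one_apply,
      Matrix.of_apply, smul_eq_mul]
    split_ifs <;> norm_num
  set Y := X.filter fun x => x ∉ Finset.univ.image q with hY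
  have hYX : ∀ x ∈ Y, x ∈ X := fun x hx => (Finset.mem_filter.1 hx).1
  have hcard : X.card ≤ Y.card + 5 := by
    have h1 := X.card_filter_add_card_filter_not fun x => x ∈ Finset.univ.image q
    have h2 : (X.filter fun x => x ∈ Finset.univ.image q).card ≤ 5 := by
      refine (Finset.card_le_card (t := Finset.univ.image q) fun x hx =>
        (Finset.mem_filter.1 hx).2).trans ?_
      simpa using Finset.card_image_le (s := Finset.univ) (f := q)
    rw [hY]
    omega
  have hmain := card_le_of_isBase hp (Y := Y) (fun x hx => hunit x (hYX x hx))
    (fun x hx y hy hxy => hpair x (hYX x hx) y (hYX y hy) hxy) fun x hx i => by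
      have hne : x ≠ q (σ i) := fun h =>
        (Finset.mem_filter.1 hx).2 (h ▸ Finset.mem_image_of_mem q (Finset.mem_univ _))
      rw [real_inner_smul_right]
      rcases hpair x (hYX x hx) _ (hq (σ i)) hne with h | h <;> rcases hd i with h' | h' <;>
        rw [h, h'] <;> norm_num
  rw [finrank_euclideanSpace_fin] at hmain
  omega

theorem mainTheorem6 (r : ℕ) (X : Finset (EuclideanSpace ℝ (Fin r)))
    (hX : IsEquiangular (1 / 5) X) (hK : baseSize (1 / 5) X = 5) :
    (23 ≤ r → r ≤ 185 → X.card ≤ 290) ∧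
      (185 ≤ r → (X.card : ℤ) ≤ (r : ℤ) + 15 + ⌊((r : ℝ) - 5) / 2⌋) := by
  have hne : X.Nonempty := by
    rw [Finset.nonempty_iff_ne_empty]
    rintro rfl
    have h : baseSizes (1 / 5) (∅ : Finset (EuclideanSpace ℝ (Fin r))) = ∅ := by
      rw [Set.eq_empty_iff_forall_notMem]
      rintro k ⟨hk, q, hq, -⟩
      exact Finset.notMem_empty _ (hq ⟨0, hk⟩)
    -- For empty `X` the supremum defaults to `0`, not `5`.
    rw [baseSize, h, csSup_empty] at hK
    exact absurd hK (by decide)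
  have h5 := (baseSize_isGreatest hX hne).1
  rw [hK] at h5
  have hmain := card_le_of_five_mem_baseSizes hX h5
  -- For `r ≤ 185`, `3r + 5 ≤ 560 < 2 · 290`. For `r ≥ 185` the target is `2|X| ≤ 3r + 25`, and `3 ·
  -- 185 + 25 = 2 · 290`.
  refine ⟨fun _ hr => by omega, fun hr => ?_⟩
  suffices h : (X.card : ℤ) - r - 15 ≤ ⌊((r : ℝ) - 5) / 2⌋ by linarith
  have h : 2 * ((X.card : ℤ) - r - 15) ≤ r - 5 := by omega
  rw [Int.le_floor, le_div_iff₀ two_pos]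
  have h' : (2 * ((X.card : ℤ) - r - 15) : ℝ) ≤ r - 5 := by exact_mod_cast h
  push_cast at h' ⊢
  linarith
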